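/- Let $H$ be a Hilbert module over a $C^*$-algebra $\mathfrak{A}$ (not assumed unital), and let $\mathcal{L}(H)$ be the $C^*$-algebra of adjointable operators on $H$, with unit $I$. Write $\mathcal{R}(T)$ for the range of $T\in\mathcal{L}(H)$ and $|T|=(T^*T)^{1/2}$. A closed submodule $M\subseteq H$ is orthogonally complemented if $H=M+M^{\perp}$; in this case $P_M$ denotes the projection of $H$ onto $M$. An operator $T\in\mathcal{L}(H)$ has the polar decomposition if $\overline{\mathcal{R}(T^*)}$ is orthogonally complemented and there is a partial isometry $U\in\mathcal{L}(H)$ with $T=U|T|$ and $U^*U=P_{\overline{\mathcal{R}(T^*)}}$. A pair $(P,Q)$ in $\mathcal{L}(H)$ is a quasi-projection pair if $P=P^*=P^2$, $Q^2=Q$, and $$PQ^*P=PQP,\qquad PQ^*(I-P)=-PQ(I-P),\qquad (I-P)Q^*(I-P)=(I-P)Q(I-P).$$ A quasi-projection pair $(P,Q)$ is semi-harmonious if $P(I-Q)$ and $(I-P)Q$ both have the polar decomposition. For an idempotent $Q\in\mathcal{L}(H)$ (that is, $Q^2=Q$), the matched projection of $Q$ is $$m(Q)=\tfrac12\big(|Q^*|+Q^*\big)\,|Q^*|^{\dagger}\,\big(|Q^*|+I\big)^{-1}\big(|Q^*|+Q\big),$$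 where $|Q^*|^{\dagger}$ is the Moore-Penrose inverse of $|Q^*|$; the matched pair of $Q$ is $(m(Q),Q)$. **Theorem.** For every idempotent $Q\in\mathcal{L}(H)$, the matched pair $(m(Q),Q)$ is semi-harmonious (in particular, a quasi-projection pair) if and only if $P_{\mathcal{R}(Q)}-Q$ has the polar decomposition. -/

import Mathlib

/-- `Adjointable A H` is the set `L(H)` of adjointable operators on the Hilbert C*-module `H`
over `A`: operators `T` that come with an operator `adj` (the adjoint) such that
`⟪T x, y⟫ = ⟪x, adj y⟫`. The adjoint is determined by `T` (see `Adjointable.ext`), and any pair of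
bare functions with this property is automatically bounded linear (see `Adjointable.ofFun`). -/
structure Adjointable (A H : Type*) [NonUnitalCStarAlgebra A] [PartialOrder A]
    [NormedAddCommGroup H] [NormedSpace ℂ H] [SMul A H] [CStarModule A H] where
  toCLM : H →L[ℂ] H
  adj : H →L[ℂ] H
  inner_eq : ∀ x y : H, inner A (toCLM x) y = inner A x (adj y)

namespace Adjointable

section Basic

variable {A H : Type*} [NonUnitalCStarAlgebra A] [PartialOrder A]
  [NormedAddCommGroup H] [NormedSpace ℂ H] [SMul A H] [CStarModule A H]

theorem eq_of_inner_left {x y : H} (h : ∀ z : H, inner A z x = inner A z y) : x = y := by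
  have h1 : inner A (x - y) (x - y) = 0 := by
    rw [CStarModule.inner_sub_right, h, sub_self]
  exact sub_eq_zero.mp (CStarModule.inner_self.mp h1)

theorem inner_eq' (T : Adjointable A H) (x y : H) :
    inner A (T.adj x) y = inner A x (T.toCLM y) := by
  rw [← CStarModule.star_inner y, ← T.inner_eq, CStarModule.star_inner]

theorem inner_swap {f g : H → H} (h : ∀ x y, inner A (f x) y = inner A x (g y)) (x y : H) :
    inner A (g x) y = inner A x (f y) := by
  rw [← CStarModule.star_inner y, ← h, CStarModule.star_inner]

theorem toCLM_injective : Function.Injective (toCLM : Adjointable A H → H →L[ℂ] H) := by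
  rintro ⟨S, S', hS⟩ ⟨T, T', hT⟩ h
  obtain rfl : S = T := h
  have : S' = T' := by
    ext y
    refine eq_of_inner_left (A := A) fun z => ?_
    rw [← hS, ← hT]
  subst this
  rfl

@[ext]
theorem ext {S T : Adjointable A H} (h : ∀ x, S.toCLM x = T.toCLM x) : S = T :=
  toCLM_injective (ContinuousLinearMap.ext h)

instance : Zero (Adjointable A H) := ⟨⟨0, 0, fun x y => by simp⟩⟩
instance : One (Adjointable A H) := ⟨⟨1, 1, fun x y => by simp⟩⟩
instance : Add (Adjointable A H) := ⟨fun S T => ⟨S.toCLM + T.toCLM, S.adj + T.adj,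
  fun x y => by simp [S.inner_eq, T.inner_eq]⟩⟩
instance : Neg (Adjointable A H) := ⟨fun S => ⟨-S.toCLM, -S.adj,
  fun x y => by simp [S.inner_eq]⟩⟩
instance : Sub (Adjointable A H) := ⟨fun S T => ⟨S.toCLM - T.toCLM, S.adj - T.adj,
  fun x y => by simp [S.inner_eq, T.inner_eq]⟩⟩
instance : Mul (Adjointable A H) := ⟨fun S T => ⟨S.toCLM * T.toCLM, T.adj * S.adj,
  fun x y => by simp [S.inner_eq, T.inner_eq]⟩⟩
instance : SMul ℂ (Adjointable A H) := ⟨fun c S => ⟨c • S.toCLM, star c • S.adj,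
  fun x y => by simp [S.inner_eq]⟩⟩
instance : SMul ℕ (Adjointable A H) := ⟨fun c S => ⟨c • S.toCLM, c • S.adj, fun x y => by
  have h := ((c : ℂ) • S).inner_eq x y
  have e1 : ((c : ℂ) • S).toCLM = c • S.toCLM := Nat.cast_smul_eq_nsmul ℂ c S.toCLM
  have e2 : ((c : ℂ) • S).adj = c • S.adj := by
    change star (c : ℂ) • S.adj = _
    rw [star_natCast, Nat.cast_smul_eq_nsmul]
  rwa [e1, e2] at h⟩⟩
instance : SMul ℤ (Adjointable A H) := ⟨fun c S => ⟨c • S.toCLM, c • S.adj, fun x y => by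
  have h := ((c : ℂ) • S).inner_eq x y
  have e1 : ((c : ℂ) • S).toCLM = c • S.toCLM := Int.cast_smul_eq_zsmul ℂ c S.toCLM
  have e2 : ((c : ℂ) • S).adj = c • S.adj := by
    change star (c : ℂ) • S.adj = _
    rw [star_intCast, Int.cast_smul_eq_zsmul]
  rwa [e1, e2] at h⟩⟩
instance : NatCast (Adjointable A H) := ⟨fun n => n • (1 : Adjointable A H)⟩
instance : IntCast (Adjointable A H) := ⟨fun n => n • (1 : Adjointable A H)⟩
instance : Pow (Adjointable A H) ℕ := ⟨fun S n => ⟨S.toCLM ^ n, S.adj ^ n, by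
  induction n with
  | zero => intro x y; simp
  | succ k ih =>
    intro x y
    rw [pow_succ', pow_succ, mul_apply_eq_comp, mul_apply_eq_comp,
      S.inner_eq, ih]⟩⟩

instance : Ring (Adjointable A H) :=
  toCLM_injective.ring toCLM rfl rfl (fun _ _ => rfl) (fun _ _ => rfl) (fun _ => rfl)
    (fun _ _ => rfl) (fun _ _ => rfl) (fun _ _ => rfl) (fun _ _ => rfl)
    (fun n => by
      change n • (1 : H →L[ℂ] H) = (n : H →L[ℂ] H)
      simp)
    (fun n => by
      change n • (1 : H →L[ℂ] H) = (n : H →L[ℂ] H)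
      simp)

instance : Algebra ℂ (Adjointable A H) :=
  letI : Module ℂ (Adjointable A H) :=
    toCLM_injective.module ℂ ⟨⟨toCLM, rfl⟩, fun _ _ => rfl⟩ (fun _ _ => rfl)
  Algebra.ofModule (fun r x y => toCLM_injective (smul_mul_assoc r x.toCLM y.toCLM))
    (fun r x y => toCLM_injective (mul_smul_comm r x.toCLM y.toCLM))

/-- The involution `T ↦ T*`. -/
instance : StarRing (Adjointable A H) where
  star T := ⟨T.adj, T.toCLM, T.inner_eq'⟩
  star_involutive _ := rfl
  star_mul _ _ := rfl
  star_add _ _ := rfl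

instance : StarModule ℂ (Adjointable A H) := ⟨fun _ _ => toCLM_injective rfl⟩

/-- The inclusion of `L(H)` into the bounded operators. -/
def toCLMHom : Adjointable A H →ₐ[ℂ] (H →L[ℂ] H) where
  toFun := toCLM
  map_one' := rfl
  map_mul' _ _ := rfl
  map_zero' := rfl
  map_add' _ _ := rfl
  commutes' c := by
    rw [Algebra.algebraMap_eq_smul_one, Algebra.algebraMap_eq_smul_one]
    rfl

/-- The operator norm. -/
noncomputable instance : NormedRing (Adjointable A H) :=
  NormedRing.induced _ _ (toCLMHom (A := A) (H := H)) toCLM_injective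

noncomputable instance : NormedAlgebra ℂ (Adjointable A H) :=
  NormedAlgebra.induced ℂ _ _ (toCLMHom (A := A) (H := H))

theorem norm_def (T : Adjointable A H) : ‖T‖ = ‖T.toCLM‖ := rfl

/-- The range `R(T)` of an operator. -/
def range (T : Adjointable A H) : Submodule ℂ H := LinearMap.range T.toCLM.toLinearMap

variable (A) in
/-- `M` is orthogonally complemented in `H`: `H = M + M^⊥`. -/
def OrthComplemented (M : Submodule ℂ H) : Prop :=
  ∀ x : H, ∃ y ∈ M, ∃ z : H, (∀ w ∈ M, inner A z w = 0) ∧ x = y + z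

theorem OrthComplemented.inner_choose {M : Submodule ℂ H} (h : OrthComplemented A M) (x y : H) :
    inner A (h x).choose y = inner A x (h y).choose := by
  obtain ⟨hx, zx, hzx, ex⟩ := (h x).choose_spec
  obtain ⟨hy, zy, hzy, ey⟩ := (h y).choose_spec
  set px := (h x).choose
  set py := (h y).choose
  have h1 : inner A px zy = 0 := by
    rw [← CStarModule.star_inner, hzy px hx, star_zero]
  rw [ey, ex, CStarModule.inner_add_right, h1, CStarModule.inner_add_left, hzx py hy]

/-- `X` is the Moore-Penrose inverse of `T`. -/
structure IsMoorePenrose (T X : Adjointable A H) : Prop where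
  mul_mul_self : T * X * T = T
  mul_mul_inv : X * T * X = X
  star_left : star (T * X) = T * X
  star_right : star (X * T) = X * T

theorem IsMoorePenrose.unique {T X Y : Adjointable A H} (hX : IsMoorePenrose T X)
    (hY : IsMoorePenrose T Y) : X = Y := by
  have h1 : T * X = T * Y := by
    calc T * X = star (T * X) := hX.star_left.symm
      _ = star ((T * Y) * (T * X)) := by rw [← mul_assoc (T * Y), hY.mul_mul_self]
      _ = (T * X) * (T * Y) := by rw [star_mul, hX.star_left, hY.star_left]
      _ = T * Y := by rw [← mul_assoc, hX.mul_mul_self]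
  have h2 : X * T = Y * T := by
    calc X * T = star (X * T) := hX.star_right.symm
      _ = star ((X * T) * (Y * T)) := by rw [mul_assoc X, ← mul_assoc T, hY.mul_mul_self]
      _ = (Y * T) * (X * T) := by rw [star_mul, hX.star_right, hY.star_right]
      _ = Y * T := by rw [mul_assoc Y, ← mul_assoc T, hX.mul_mul_self]
  calc X = X * T * X := hX.mul_mul_inv.symm
    _ = Y * T * Y := by rw [h2, mul_assoc, h1, ← mul_assoc]
    _ = Y := hY.mul_mul_inv

open Classical in
/-- The Moore-Penrose inverse `T^†` (by convention `0` if there is none). -/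
noncomputable def pinv (T : Adjointable A H) : Adjointable A H :=
  if h : ∃ X, IsMoorePenrose T X then h.choose else 0

end Basic

section CStar

variable {A H : Type*} [NonUnitalCStarAlgebra A] [PartialOrder A] [StarOrderedRing A]
  [NormedAddCommGroup H] [NormedSpace ℂ H] [SMul A H] [CStarModule A H]

theorem norm_mul_self_le (T : Adjointable A H) : ‖T‖ * ‖T‖ ≤ ‖star T * T‖ := by
  rw [← pow_two]
  refine Real.le_sqrt (norm_nonneg _) (norm_nonneg _) |>.mp ?_
  rw [norm_def T]
  refine ContinuousLinearMap.opNorm_le_bound _ (Real.sqrt_nonneg _) fun x => ?_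
  refine (sq_le_sq₀ (norm_nonneg _) (by positivity)).mp ?_
  calc ‖T.toCLM x‖ ^ 2 = ‖inner A (T.toCLM x) (T.toCLM x)‖ := CStarModule.norm_sq_eq A
    _ = ‖inner A x ((star T * T).toCLM x)‖ := by rw [T.inner_eq]; rfl
    _ ≤ ‖x‖ * ‖(star T * T).toCLM x‖ := CStarModule.norm_inner_le H
    _ ≤ ‖x‖ * (‖star T * T‖ * ‖x‖) := by
      gcongr
      exact (star T * T).toCLM.le_opNorm x
    _ = (√‖star T * T‖ * ‖x‖) ^ 2 := by
      rw [mul_pow, Real.sq_sqrt (norm_nonneg _)]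
      ring

instance : CStarRing (Adjointable A H) := ⟨norm_mul_self_le⟩

instance [CompleteSpace H] : CompleteSpace (Adjointable A H) := by
  refine Metric.complete_of_cauchySeq_tendsto fun u hu => ?_
  have h1 : CauchySeq fun n => (u n).toCLM := by
    rw [Metric.cauchySeq_iff] at hu ⊢
    simp only [dist_eq_norm] at hu ⊢
    exact hu
  have h2 : CauchySeq fun n => (u n).adj := by
    rw [Metric.cauchySeq_iff] at hu ⊢
    intro ε hε
    obtain ⟨N, hN⟩ := hu ε hε
    refine ⟨N, fun m hm n hn => ?_⟩
    have h3 := hN m hm n hn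
    rw [dist_eq_norm, ← norm_star] at h3
    rw [dist_eq_norm]
    exact h3
  obtain ⟨S, hS⟩ := cauchySeq_tendsto_of_complete h1
  obtain ⟨S', hS'⟩ := cauchySeq_tendsto_of_complete h2
  have key : ∀ x y : H, inner A (S x) y = inner A x (S' y) := by
    intro x y
    have l1 : Filter.Tendsto (fun n => inner A ((u n).toCLM x) y) Filter.atTop
        (nhds (inner A (S x) y)) :=
      (CStarModule.continuous_inner.comp (continuous_id.prodMk continuous_const)).continuousAt.tendsto.comp
        (((ContinuousLinearMap.apply ℂ H x).continuous.tendsto S).comp hS)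
    have l2 : Filter.Tendsto (fun n => inner A x ((u n).adj y)) Filter.atTop
        (nhds (inner A x (S' y))) :=
      (CStarModule.continuous_inner.comp (continuous_const.prodMk continuous_id)).continuousAt.tendsto.comp
        (((ContinuousLinearMap.apply ℂ H y).continuous.tendsto S').comp hS')
    simp only [(u _).inner_eq] at l1
    exact tendsto_nhds_unique l1 l2
  refine ⟨⟨S, S', key⟩, ?_⟩
  rw [Metric.tendsto_atTop] at hS ⊢
  simp only [dist_eq_norm] at hS ⊢
  exact hS

variable [CompleteSpace H]

/-- `L(H)` is a C*-algebra. -/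
noncomputable instance : CStarAlgebra (Adjointable A H) where

/-- The order of the C*-algebra `L(H)`, with the usual positive elements. -/
noncomputable instance : PartialOrder (Adjointable A H) := CStarAlgebra.spectralOrder _

instance : StarOrderedRing (Adjointable A H) := CStarAlgebra.spectralOrderedRing _

theorem exists_toCLM (f g : H → H) (h : ∀ x y, inner A (g x) y = inner A x (f y)) :
    ∃ F : H →L[ℂ] H, ∀ x, F x = f x := by
  let L : H →ₗ[ℂ] H :=
    { toFun := f
      map_add' := fun x y => eq_of_inner_left (A := A) fun z => by
        rw [CStarModule.inner_add_right, ← h, ← h, ← h, CStarModule.inner_add_right]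
      map_smul' := fun c x => eq_of_inner_left (A := A) fun z => by
        rw [RingHom.id_apply, CStarModule.inner_smul_right_complex, ← h, ← h,
          CStarModule.inner_smul_right_complex] }
  refine ⟨⟨L, L.continuous_of_seq_closed_graph fun u x y hx hy => ?_⟩, fun x => rfl⟩
  refine eq_of_inner_left (A := A) fun z => ?_
  have l1 : Filter.Tendsto (fun n => inner A z (L (u n))) Filter.atTop (nhds (inner A z y)) :=
    (CStarModule.continuous_inner.comp
      (continuous_const.prodMk continuous_id)).continuousAt.tendsto.comp hy
  have l2 : Filter.Tendsto (fun n => inner A (g z) (u n)) Filter.atTop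
      (nhds (inner A (g z) x)) :=
    (CStarModule.continuous_inner.comp
      (continuous_const.prodMk continuous_id)).continuousAt.tendsto.comp hx
  simp only [h] at l2
  exact tendsto_nhds_unique l1 l2

/-- Any function `f` with an adjoint function `g` is an adjointable operator. -/
noncomputable def ofFun (f g : H → H) (h : ∀ x y, inner A (f x) y = inner A x (g y)) :
    Adjointable A H where
  toCLM := (exists_toCLM f g (inner_swap h)).choose
  adj := (exists_toCLM g f h).choose
  inner_eq x y := by
    rw [(exists_toCLM f g (inner_swap h)).choose_spec, (exists_toCLM g f h).choose_spec, h]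

theorem ofFun_apply (f g : H → H) (h : ∀ x y, inner A (f x) y = inner A x (g y)) (x : H) :
    (ofFun f g h).toCLM x = f x :=
  (exists_toCLM f g (inner_swap h)).choose_spec x

open Classical in
variable (A) in
/-- The projection `P_M` of `H` onto an orthogonally complemented `M`: it sends `y + z` to `y` for
`y ∈ M` and `z ∈ M^⊥` (and by convention it is `0` if `M` is not orthogonally complemented). -/
noncomputable def orthProj (M : Submodule ℂ H) : Adjointable A H :=
  if h : OrthComplemented A M then
    ofFun (fun x => (h x).choose) (fun x => (h x).choose) h.inner_choose
  else 0

theorem orthProj_add {M : Submodule ℂ H} (h : OrthComplemented A M) {y z : H} (hy : y ∈ M)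
    (hz : ∀ w ∈ M, inner A z w = 0) : (orthProj A M).toCLM (y + z) = y := by
  rw [orthProj, dif_pos h, ofFun_apply]
  obtain ⟨hp, z', hz', e⟩ := (h (y + z)).choose_spec
  set p := (h (y + z)).choose
  have hm : p - y ∈ M := M.sub_mem hp hy
  have e' : p - y = z - z' := by
    rw [sub_eq_sub_iff_add_eq_add, ← e, add_comm]
  have h0 : inner A (p - y) (p - y) = 0 := by
    nth_rewrite 1 [e']
    rw [CStarModule.inner_sub_left, hz _ hm, hz' _ hm, sub_zero]
  exact sub_eq_zero.mp (CStarModule.inner_self.mp h0)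

/-- The matched projection of an idempotent `Q`,
`m(Q) = 1/2 (|Q*| + Q*) |Q*|^† (|Q*| + I)⁻¹ (|Q*| + Q)`, where `|T|` is the square root of
`T* T`, written `CFC.abs T`. -/
noncomputable def matchedProj (Q : Adjointable A H) : Adjointable A H :=
  (1 / 2 : ℂ) • ((CFC.abs (star Q) + star Q) * pinv (CFC.abs (star Q)) *
    Ring.inverse (CFC.abs (star Q) + 1) * (CFC.abs (star Q) + Q))

/-! The operations in the definition of `m(Q)` are not used outside their domains. -/

theorem exists_range_projection {Q : Adjointable A H} (hQ : IsIdempotentElem Q) :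
    ∃ P : Adjointable A H, star P = P ∧ P * Q = Q ∧ Q * P = P := by
  have hQ' : Q * Q = Q := hQ
  have hS : star Q * star Q = star Q := by rw [← star_mul, hQ']
  have e : 1 + star (Q - star Q) * (Q - star Q) =
      1 - Q - star Q + Q * star Q + star Q * Q := by
    rw [star_sub, star_star, sub_mul, mul_sub, mul_sub, hS, hQ']
    abel
  have hu : IsUnit (1 - Q - star Q + Q * star Q + star Q * Q) := by
    rw [← e]
    exact (IsStrictlyPositive.add_nonneg (by simp) (star_mul_self_nonneg (Q - star Q))).isUnit
  obtain ⟨w, hw⟩ := hu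
  have c1 : (w : Adjointable A H) * Q = Q * star Q * Q := by
    rw [hw]
    simp only [add_mul, sub_mul, one_mul, mul_assoc, hQ']
    abel
  have c1' : Q * (w : Adjointable A H) = Q * star Q * Q := by
    rw [hw]
    simp only [mul_add, mul_sub, mul_one, ← mul_assoc, hQ']
    abel
  have c2 : (w : Adjointable A H) * star Q = star Q * Q * star Q := by
    rw [hw]
    simp only [add_mul, sub_mul, one_mul, mul_assoc, hS]
    abel
  have c2' : star Q * (w : Adjointable A H) = star Q * Q * star Q := by
    rw [hw]
    simp only [mul_add, mul_sub, mul_one, ← mul_assoc, hS]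
    abel
  have hc : Commute (Q * star Q) (w : Adjointable A H) :=
    Commute.mul_left (c1'.trans c1.symm) (c2'.trans c2.symm)
  have hsw : star (w : Adjointable A H) = w := by
    rw [hw]
    simp only [star_add, star_sub, star_mul, star_star, star_one]
    abel
  have hc' : Commute (Q * star Q) (↑w⁻¹ : Adjointable A H) := hc.units_inv_right
  have hsw' : star (↑w⁻¹ : Adjointable A H) = ↑w⁻¹ := by
    have : star w = w := Units.ext hsw
    rw [← Units.coe_star, star_inv, this]
  refine ⟨Q * star Q * ↑w⁻¹, ?_, ?_, ?_⟩
  · rw [star_mul, hsw', star_mul, star_star, hc'.eq]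
  · rw [hc'.eq, mul_assoc, ← c1, Units.inv_mul_cancel_left]
  · rw [← mul_assoc, ← mul_assoc, hQ']

/-- The range of an idempotent is orthogonally complemented. -/
theorem orthComplemented_range {Q : Adjointable A H} (hQ : IsIdempotentElem Q) :
    OrthComplemented A (range Q) := by
  obtain ⟨P, hP, hPQ, hQP⟩ := exists_range_projection hQ
  intro x
  refine ⟨P.toCLM x, ⟨P.toCLM x, congrArg (fun T : Adjointable A H => T.toCLM x) hQP⟩,
    x - P.toCLM x, ?_, by abel⟩
  rintro _ ⟨y, rfl⟩
  have h1 : inner A (P.toCLM x) (Q.toCLM y) = inner A x (P.toCLM (Q.toCLM y)) := by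
    rw [P.inner_eq]
    exact congrArg (fun T : Adjointable A H => inner A x (T.toCLM (Q.toCLM y))) hP
  have h2 : P.toCLM (Q.toCLM y) = Q.toCLM y :=
    congrArg (fun T : Adjointable A H => T.toCLM y) hPQ
  have h3 : inner A (x - P.toCLM x) (Q.toCLM y) = 0 := by
    rw [CStarModule.inner_sub_left, h1, h2, sub_self]
  exact h3

theorem isUnit_abs_add_one (T : Adjointable A H) : IsUnit (CFC.abs T + 1) :=
  (IsStrictlyPositive.nonneg_add (CFC.abs_nonneg T) (by simp)).isUnit

theorem isMoorePenrose_pinv {Q : Adjointable A H} (hQ : IsIdempotentElem Q) :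
    IsMoorePenrose (CFC.abs (star Q)) (pinv (CFC.abs (star Q))) := by
  have hS : IsIdempotentElem (star Q) := by
    change star Q * star Q = star Q
    rw [← star_mul, hQ.eq]
  obtain ⟨P, hP, hPQ, hQP⟩ := exists_range_projection hQ
  obtain ⟨R, hR, hRS, hSR⟩ := exists_range_projection hS
  have hPP : P * P = P := by
    nth_rewrite 2 [← hQP]
    rw [← mul_assoc, hPQ, hQP]
  have hSP : star Q * P = star Q := by
    rw [← hP, ← star_mul, hPQ]
  have hQR : Q * R = Q := by
    have := congrArg star hRS
    rwa [star_mul, star_star, hR] at this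
  set a := CFC.abs (star Q) with ha
  have haa : a * a = Q * star Q := by
    rw [ha, CFC.abs_mul_abs, star_star]
  have hsa : star a = a := (CFC.abs_nonneg (star Q)).isSelfAdjoint
  set y := P * R * P with hy
  have hsy : star y = y := by
    rw [hy, star_mul, star_mul, hP, hR, mul_assoc]
  have h1 : a * a * y = P := by
    calc a * a * y = Q * (star Q * P) * R * P := by rw [haa, hy]; simp only [mul_assoc]
      _ = Q * (star Q * R) * P := by rw [hSP]; simp only [mul_assoc]
      _ = P := by rw [hSR, hQR, hQP]
  have h2 : y * (a * a) = P := by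
    have := congrArg star h1
    rwa [star_mul (a * a) y, star_mul a a, hsa, hsy, hP] at this
  have hc : Commute a y := by
    have h3 : Commute (a * a) y := h1.trans h2.symm
    rw [ha, CFC.abs, CFC.sqrt, star_star, ← haa]
    exact h3.cfcₙ_nnreal _
  have h0 : a * (1 - P) = 0 := by
    rw [← CStarRing.star_mul_self_eq_zero_iff, star_mul, hsa]
    have : a * a * (1 - P) = 0 := by
      rw [haa, mul_sub, mul_one, mul_assoc, hSP, sub_self]
    rw [mul_assoc, ← mul_assoc a, this, mul_zero]
  have haP : a * P = a := by
    rw [mul_sub, mul_one, sub_eq_zero] at h0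
    exact h0.symm
  have hex : ∃ X, IsMoorePenrose a X := by
    have e1 : a * (a * y) = P := by rw [← mul_assoc, h1]
    have e2 : a * y * a = P := by rw [hc.eq, mul_assoc, h2]
    refine ⟨a * y, ?_, ?_, ?_, ?_⟩
    · rw [mul_assoc, e2, haP]
    · rw [e2, hc.eq, ← mul_assoc, hy, ← mul_assoc, ← mul_assoc, hPP]
    · rw [e1, hP]
    · rw [e2, hP]
  rw [pinv, dif_pos hex]
  exact hex.choose_spec

/-- `(P, Q)` is a quasi-projection pair. -/
structure IsQuasiProjectionPair (P Q : Adjointable A H) : Prop where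
  isStarProjection : IsStarProjection P
  isIdempotentElem : IsIdempotentElem Q
  corner_left : P * star Q * P = P * Q * P
  off_diagonal : P * star Q * (1 - P) = -(P * Q * (1 - P))
  corner_right : (1 - P) * star Q * (1 - P) = (1 - P) * Q * (1 - P)

/-- `T` has the polar decomposition: `T = U |T|` for a partial isometry `U` such that `U* U` is
the projection onto the closure of the range of `T*`. -/
def HasPolarDecomposition (T : Adjointable A H) : Prop :=
  OrthComplemented A (range (star T)).topologicalClosure ∧
    ∃ U : Adjointable A H, U * star U * U = U ∧ T = U * CFC.abs T ∧
      star U * U = orthProj A (range (star T)).topologicalClosure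

/-- The quasi-projection pair `(P, Q)` is semi-harmonious: `P (I - Q)` and `(I - P) Q` both have
the polar decomposition. -/
structure IsSemiHarmonious (P Q : Adjointable A H) : Prop where
  isQuasiProjectionPair : IsQuasiProjectionPair P Q
  polar_left : HasPolarDecomposition (P * (1 - Q))
  polar_right : HasPolarDecomposition ((1 - P) * Q)

end CStar

end Adjointable

/-! An operator `T` has the polar decomposition exactly when the closures of both `R(T)` and `R(T*)`
are orthogonally complemented (`hasPolarDecomposition_iff`). The property is therefore stable under
adjoints. It also passes between `T` and `S T` whenever some `L` satisfies `L S T = T`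
(`hasPolarDecomposition_mul_iff`), and this reduces the theorem to finding such left inverses.

Put `p = P_{R(Q)}`, `a = |Q*|`, `c = a^†`, `d = (a + 1)⁻¹`, `m = m(Q)` and `N = p - Q`, so that `2m
= (a + Q*) c d (a + Q)`. Everything rests on `(a + Q)(a + Q*) = 2a(a + 1)` and `c d a (a + 1) = p`.
They make `m` a projection, and `(2m - 1) Q = Q* (2m - 1)` gives the quasi-projection identities.

For the first operator, `2m(1 - Q) = (a + Q*) d N`, and `c (a + Q)` undoes the left factor up to the
scalar 2. So `m(1 - Q)` has the polar decomposition iff `N` does, which already gives one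
implication.

For the second, `2Q*(1 - m) = Q* c (a - Q)`, where `a` undoes `Q* c`. The adjoint of `a - Q` is `a -
Q* = (1 + d N) N*`, where `1 - p` undoes `1 + d N`. Together with passage to adjoints this carries
the polar decomposition from `N` to `(1 - m) Q`. -/

namespace Adjointable

/-! ### Range closures and isometric transfer between operators -/

section Range

variable {A H : Type*} [NonUnitalCStarAlgebra A] [PartialOrder A]
  [NormedAddCommGroup H] [NormedSpace ℂ H] [SMul A H] [CStarModule A H]

theorem mul_apply (S T : Adjointable A H) (x : H) : (S * T).toCLM x = S.toCLM (T.toCLM x) := rfl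

theorem inner_apply (T : Adjointable A H) (x y : H) :
    inner A (T.toCLM x) y = inner A x ((star T).toCLM y) := T.inner_eq x y

theorem apply_mem_range (T : Adjointable A H) (x : H) : T.toCLM x ∈ range T := ⟨x, rfl⟩

theorem apply_mem_closure (T : Adjointable A H) (x : H) :
    T.toCLM x ∈ (range T).topologicalClosure :=
  (range T).le_topologicalClosure (apply_mem_range T x)

theorem range_mul_le (S T : Adjointable A H) : range (S * T) ≤ range S := by
  rintro _ ⟨x, rfl⟩
  exact apply_mem_range S (T.toCLM x)

theorem map_mem_closure_range (S T : Adjointable A H) {x : H}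
    (hx : x ∈ (range T).topologicalClosure) : S.toCLM x ∈ (range (S * T)).topologicalClosure := by
  refine map_mem_closure S.toCLM.continuous hx ?_
  rintro _ ⟨y, rfl⟩
  exact apply_mem_range (S * T) y

/-- An identity `S = T` that holds on the range of `X` holds on its closure. -/
theorem eqOn_closure_range {S T X : Adjointable A H} (h : S * X = T * X) {x : H}
    (hx : x ∈ (range X).topologicalClosure) : S.toCLM x = T.toCLM x := by
  have hc : IsClosed {y : H | S.toCLM y = T.toCLM y} :=
    isClosed_eq S.toCLM.continuous T.toCLM.continuous
  refine closure_minimal ?_ hc hx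
  rintro _ ⟨y, rfl⟩
  exact congrArg (fun R : Adjointable A H => R.toCLM y) h

theorem closure_range_le {E T : Adjointable A H} (hT : E * T = T) :
    (range T).topologicalClosure ≤ range E := fun x hx => by
  have := eqOn_closure_range (S := E) (T := 1) (X := T) (by rw [hT, one_mul]) hx
  exact ⟨x, this⟩

/-- The range closure of `T` is orthogonally complemented as soon as it is the range of a
self-adjoint idempotent. -/
theorem orthComplemented_of_projection {M : Submodule ℂ H} {E : Adjointable A H}
    (hs : star E = E) (hM : ∀ x, E.toCLM x ∈ M) (hE : ∀ x ∈ M, E.toCLM x = x) :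
    OrthComplemented A M := by
  intro x
  refine ⟨E.toCLM x, hM x, x - E.toCLM x, fun w hw => ?_, by abel⟩
  rw [CStarModule.inner_sub_left, inner_apply, hs, hE w hw, sub_self]

/-- Equal moduli make `S x ↦ T x` a well-defined isometry; it is used with `S = |T|`, in both
directions. -/
theorem norm_apply_eq {S T : Adjointable A H} (h : star S * S = star T * T) (x : H) :
    ‖S.toCLM x‖ = ‖T.toCLM x‖ := by
  rw [← sq_eq_sq₀ (norm_nonneg _) (norm_nonneg _), CStarModule.norm_sq_eq A,
    CStarModule.norm_sq_eq A, inner_apply, inner_apply, ← mul_apply, ← mul_apply, h]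

theorem inner_apply_apply_eq {S T : Adjointable A H} (h : star S * S = star T * T) (x y : H) :
    inner A (S.toCLM x) (S.toCLM y) = inner A (T.toCLM x) (T.toCLM y) := by
  rw [inner_apply, inner_apply, ← mul_apply, ← mul_apply, h]

theorem tendsto_inner [StarOrderedRing A] {u v : ℕ → H} {x y : H}
    (hu : Filter.Tendsto u Filter.atTop (nhds x))
    (hv : Filter.Tendsto v Filter.atTop (nhds y)) :
    Filter.Tendsto (fun n => (inner A (u n) (v n) : A)) Filter.atTop (nhds (inner A x y)) := by
  have hc : Continuous fun q : H × H => (inner A q.1 q.2 : A) := CStarModule.continuous_inner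
  exact (hc.tendsto (x, y)).comp (hu.prodMk_nhds hv)

theorem IsMoorePenrose.star {T X : Adjointable A H} (h : IsMoorePenrose T X) :
    IsMoorePenrose (star T) (star X) where
  mul_mul_self := by rw [← star_mul, ← star_mul, ← mul_assoc, h.mul_mul_self]
  mul_mul_inv := by rw [← star_mul, ← star_mul, ← mul_assoc, h.mul_mul_inv]
  star_left := by rw [← star_mul, h.star_right, h.star_right]
  star_right := by rw [← star_mul, h.star_left, h.star_left]

/-- If `S x ↦ T x` is isometric, then limits transfer from `S` to `T`. -/
theorem tendsto_of_tendsto {S T : Adjointable A H} (h : star S * S = star T * T) {z w : ℕ → H}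
    {u v : H} (hz : Filter.Tendsto (fun n => S.toCLM (z n)) Filter.atTop (nhds u))
    (hw : Filter.Tendsto (fun n => S.toCLM (w n)) Filter.atTop (nhds u))
    (hv : Filter.Tendsto (fun n => T.toCLM (z n)) Filter.atTop (nhds v)) :
    Filter.Tendsto (fun n => T.toCLM (w n)) Filter.atTop (nhds v) := by
  have h1 : Filter.Tendsto (fun n => T.toCLM (w n - z n)) Filter.atTop (nhds 0) := by
    rw [tendsto_zero_iff_norm_tendsto_zero]
    have h2 := (hw.sub hz).norm
    rw [sub_self, norm_zero] at h2
    refine h2.congr fun n => ?_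
    rw [← map_sub, norm_apply_eq h]
  have := h1.add hv
  simpa using this

/-- The isometry `S x ↦ T x` sends Cauchy sequences to Cauchy sequences, so it extends to the
closure of `R(S)`. The approximating sequence is kept so that later identities can be checked by
passing to limits. -/
theorem exists_transfer [CompleteSpace H] {S T : Adjointable A H} (h : star S * S = star T * T)
    {u : H} (hu : u ∈ (range S).topologicalClosure) :
    ∃ v : H, ∃ z : ℕ → H, Filter.Tendsto (fun n => S.toCLM (z n)) Filter.atTop (nhds u) ∧
      Filter.Tendsto (fun n => T.toCLM (z n)) Filter.atTop (nhds v) := by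
  obtain ⟨s, hs, hsu⟩ := mem_closure_iff_seq_limit.mp hu
  choose z hz using hs
  have hz' : Filter.Tendsto (fun n => S.toCLM (z n)) Filter.atTop (nhds u) := by
    refine hsu.congr fun n => ?_
    exact (hz n).symm
  have hc : CauchySeq fun n => T.toCLM (z n) := by
    have hc' := hz'.cauchySeq
    rw [Metric.cauchySeq_iff] at hc' ⊢
    simp only [dist_eq_norm, ← map_sub, norm_apply_eq h] at hc' ⊢
    exact hc'
  obtain ⟨v, hv⟩ := cauchySeq_tendsto_of_complete hc
  exact ⟨v, z, hz', hv⟩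

end Range

/-! ### Polar decomposition and complemented range closures -/

section Polar

variable {A H : Type*} [NonUnitalCStarAlgebra A] [PartialOrder A] [StarOrderedRing A]
  [NormedAddCommGroup H] [NormedSpace ℂ H] [SMul A H] [CStarModule A H] [CompleteSpace H]

theorem orthProj_apply_mem {M : Submodule ℂ H} (h : OrthComplemented A M) (x : H) :
    (orthProj A M).toCLM x ∈ M := by
  obtain ⟨y, hy, z, hz, rfl⟩ := h x
  rwa [orthProj_add h hy hz]

theorem orthProj_apply_of_mem {M : Submodule ℂ H} (h : OrthComplemented A M) {x : H}
    (hx : x ∈ M) : (orthProj A M).toCLM x = x := by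
  have := orthProj_add h hx (z := 0) fun w _ => CStarModule.inner_zero_left
  rwa [add_zero] at this

theorem star_orthProj {M : Submodule ℂ H} (h : OrthComplemented A M) :
    star (orthProj A M) = orthProj A M := by
  refine ext fun x => eq_of_inner_left (A := A) fun w => ?_
  rw [← inner_apply]
  obtain ⟨y, hy, z, hz, rfl⟩ := h x
  obtain ⟨y', hy', z', hz', rfl⟩ := h w
  rw [orthProj_add h hy hz, orthProj_add h hy' hz', CStarModule.inner_add_right,
    CStarModule.inner_add_left, hz' y hy, ← CStarModule.star_inner z, hz y' hy', star_zero]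

theorem orthProj_mul_self {M : Submodule ℂ H} (h : OrthComplemented A M) :
    orthProj A M * orthProj A M = orthProj A M :=
  ext fun x => orthProj_apply_of_mem h (orthProj_apply_mem h x)

theorem orthProj_mul_of_range_le {M : Submodule ℂ H} (h : OrthComplemented A M)
    {T : Adjointable A H} (hT : range T ≤ M) : orthProj A M * T = T :=
  ext fun x => orthProj_apply_of_mem h (hT (apply_mem_range T x))

/-- `T` is a limit of operators `T T* k T`. -/
theorem exists_norm_sub_lt (T : Adjointable A H) {δ : ℝ} (hδ : 0 < δ) :
    ∃ X : Adjointable A H, ‖T - T * star T * X‖ < δ := by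
  set b := T * star T with hb
  have hb0 : 0 ≤ b := mul_star_self_nonneg T
  have hsa : IsSelfAdjoint b := hb0.isSelfAdjoint
  have hsp : ∀ t ∈ spectrum ℝ b, 0 ≤ t := fun t ht => spectrum_nonneg_of_nonneg hb0 ht
  obtain ⟨ε, hε, hεδ⟩ : ∃ ε : ℝ, 0 < ε ∧ ε < δ ^ 2 := exists_between (by positivity)
  have hne : ∀ t ∈ spectrum ℝ b, t + ε ≠ 0 := fun t ht => by
    have := hsp t ht
    positivity
  -- With `k = (b + ε)⁻¹` the error is `r T`, where `r = 1 - b k = ε (b + ε)⁻¹`, and `‖r T‖² = ‖r b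
  -- r‖ ≤ ε < δ²`.
  have hk : ContinuousOn (fun t : ℝ => (t + ε)⁻¹) (spectrum ℝ b) :=
    (continuousOn_id.add continuousOn_const).inv₀ hne
  set k := cfc (fun t : ℝ => (t + ε)⁻¹) b
  have hr : cfc (fun t : ℝ => 1 - t * (t + ε)⁻¹) b = 1 - b * k := by
    rw [cfc_sub (fun _ => 1) (fun t : ℝ => t * (t + ε)⁻¹) b continuousOn_const
      (continuousOn_id.mul hk), cfc_const_one ℝ b,
      cfc_mul (fun t : ℝ => t) (fun t : ℝ => (t + ε)⁻¹) b continuousOn_id hk, cfc_id' ℝ b]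
  have hrc : ContinuousOn (fun t : ℝ => 1 - t * (t + ε)⁻¹) (spectrum ℝ b) :=
    continuousOn_const.sub (continuousOn_id.mul hk)
  set r := cfc (fun t : ℝ => 1 - t * (t + ε)⁻¹) b
  have hrs : star r = r := IsSelfAdjoint.cfc
  have hrb : cfc (fun t : ℝ => (1 - t * (t + ε)⁻¹) * t * (1 - t * (t + ε)⁻¹)) b = r * b * r := by
    rw [cfc_mul (fun t : ℝ => (1 - t * (t + ε)⁻¹) * t) (fun t : ℝ => 1 - t * (t + ε)⁻¹) b
      (hrc.mul continuousOn_id) hrc,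
      cfc_mul (fun t : ℝ => 1 - t * (t + ε)⁻¹) (fun t : ℝ => t) b hrc continuousOn_id,
      cfc_id' ℝ b]
  have hnorm : ‖r * b * r‖ ≤ ε := by
    rw [← hrb]
    refine norm_cfc_le hε.le fun t ht => ?_
    have h0 := hsp t ht
    have e : 1 - t * (t + ε)⁻¹ = ε / (t + ε) := by
      have := hne t ht
      field_simp
      ring
    rw [e, Real.norm_of_nonneg (by positivity)]
    have h1 : t / (t + ε) ≤ 1 := by
      rw [div_le_one (by positivity)]
      linarith
    have h2 : ε / (t + ε) ≤ 1 := by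
      rw [div_le_one (by positivity)]
      linarith
    calc ε / (t + ε) * t * (ε / (t + ε)) = ε * (t / (t + ε)) * (ε / (t + ε)) := by ring
      _ ≤ ε * 1 * 1 := by gcongr
      _ = ε := by ring
  refine ⟨k * T, ?_⟩
  have e : T - b * (k * T) = r * T := by rw [hr, sub_mul, one_mul, ← mul_assoc]
  rw [e]
  refine lt_of_pow_lt_pow_left₀ 2 hδ.le ?_
  rw [sq, ← CStarRing.norm_self_mul_star, star_mul, hrs]
  have e2 : r * T * (star T * r) = r * b * r := by rw [hb]; simp only [mul_assoc]
  rw [e2]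
  exact hnorm.trans_lt hεδ

theorem closure_range_mul_star (T : Adjointable A H) :
    (range (T * star T)).topologicalClosure = (range T).topologicalClosure := by
  refine le_antisymm (Submodule.topologicalClosure_mono (range_mul_le T (star T))) ?_
  refine Submodule.topologicalClosure_minimal _ ?_ (Submodule.isClosed_topologicalClosure _)
  rintro _ ⟨x, rfl⟩
  refine Metric.mem_closure_iff.mpr fun ε hε => ?_
  -- The `+ 1` keeps the denominator positive when `x = 0`.
  obtain ⟨X, hX⟩ := exists_norm_sub_lt T (δ := ε / (‖x‖ + 1)) (by positivity)
  refine ⟨(T * star T * X).toCLM x, range_mul_le _ _ (apply_mem_range _ x), ?_⟩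
  rw [dist_eq_norm]
  calc ‖(T - T * star T * X).toCLM x‖ ≤ ‖T - T * star T * X‖ * ‖x‖ :=
        (T - T * star T * X).toCLM.le_opNorm x
    _ ≤ ε / (‖x‖ + 1) * ‖x‖ := by gcongr
    _ < ε / (‖x‖ + 1) * (‖x‖ + 1) := by gcongr; linarith
    _ = ε := by field_simp

theorem star_abs (T : Adjointable A H) : star (CFC.abs T) = CFC.abs T :=
  (CFC.abs_nonneg T).isSelfAdjoint

theorem closure_range_abs (T : Adjointable A H) :
    (range (CFC.abs T)).topologicalClosure = (range (star T)).topologicalClosure := by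
  rw [← closure_range_mul_star (CFC.abs T), ← closure_range_mul_star (star T), star_abs,
    CFC.abs_mul_abs, star_star]

/-- The projection onto the closure of `R(T)` is `U U*`: it fixes `R(T)`, and its values lie in the
image under `U` of the closure of `R(|T|)`, hence in the closure of `R(T)`. -/
theorem HasPolarDecomposition.orthComplemented {T : Adjointable A H}
    (h : HasPolarDecomposition T) : OrthComplemented A (range T).topologicalClosure := by
  obtain ⟨hc, U, hU, hT, hUU⟩ := h
  have hET : U * star U * T = T := by
    conv_lhs => rw [hT]
    rw [← mul_assoc, hU, ← hT]
  refine orthComplemented_of_projection (E := U * star U) (by rw [star_mul, star_star])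
    (fun x => ?_) fun x hx => ?_
  · have h1 : (U * star U).toCLM x = U.toCLM ((star U * U).toCLM ((star U).toCLM x)) := by
      rw [← mul_apply, ← mul_apply, ← mul_assoc, hU]
    have h2 : (star U * U).toCLM ((star U).toCLM x) ∈ (range (star T)).topologicalClosure := by
      rw [hUU]
      exact orthProj_apply_mem hc _
    rw [h1]
    rw [← closure_range_abs] at h2
    have h3 := map_mem_closure_range U (CFC.abs T) h2
    rwa [← hT] at h3
  · exact eqOn_closure_range (S := U * star U) (T := 1) (X := T) (by rw [hET, one_mul]) hx

/-- `U` is the extension `φ` of `|T| x ↦ T x` preceded by the projection `E`, and `U*` is the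
extension `ψ` of `T x ↦ |T| x` preceded by `F`. Complementedness of the closure of `R(T)` is what
makes this adjoint available. Linearity and boundedness come for free from the adjoint relation
through `ofFun`. -/
theorem hasPolarDecomposition_of_orthComplemented {T : Adjointable A H}
    (h1 : OrthComplemented A (range (star T)).topologicalClosure)
    (h2 : OrthComplemented A (range T).topologicalClosure) : HasPolarDecomposition T := by
  set E := orthProj A (range (star T)).topologicalClosure
  set F := orthProj A (range T).topologicalClosure
  set a := CFC.abs T with ha
  have hsa : star a = a := star_abs T
  have hiso : star a * a = star T * T := by rw [hsa, ha, CFC.abs_mul_abs]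
  have hmE : ∀ x, E.toCLM x ∈ (range a).topologicalClosure := fun x => by
    rw [ha, closure_range_abs]
    exact orthProj_apply_mem h1 x
  have hmF : ∀ x, F.toCLM x ∈ (range T).topologicalClosure := orthProj_apply_mem h2
  have hEE : ∀ x, E.toCLM (E.toCLM x) = E.toCLM x := fun x =>
    orthProj_apply_of_mem h1 (orthProj_apply_mem h1 x)
  choose φ hφ using fun u : (range a).topologicalClosure => exists_transfer hiso u.2
  choose ψ hψ using fun u : (range T).topologicalClosure => exists_transfer hiso.symm u.2
  have hφT : ∀ u, φ u ∈ (range T).topologicalClosure := fun u => by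
    obtain ⟨z, -, hz⟩ := hφ u
    exact mem_closure_of_tendsto hz (Filter.Eventually.of_forall fun n => apply_mem_range T _)
  have hψa : ∀ u, ψ u ∈ (range (star T)).topologicalClosure := fun u => by
    obtain ⟨z, -, hz⟩ := hψ u
    rw [← closure_range_abs]
    exact mem_closure_of_tendsto hz (Filter.Eventually.of_forall fun n => apply_mem_range a _)
  have hadj : ∀ x y, inner A (φ ⟨E.toCLM x, hmE x⟩) y = inner A x (ψ ⟨F.toCLM y, hmF y⟩) := by
    intro x y
    have e1 : inner A (φ ⟨E.toCLM x, hmE x⟩) y =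
        inner A (φ ⟨E.toCLM x, hmE x⟩) (F.toCLM y) := by
      conv_lhs => rw [← orthProj_apply_of_mem h2 (hφT ⟨E.toCLM x, hmE x⟩)]
      rw [inner_apply, star_orthProj h2]
    have e2 : inner A x (ψ ⟨F.toCLM y, hmF y⟩) =
        inner A (E.toCLM x) (ψ ⟨F.toCLM y, hmF y⟩) := by
      conv_lhs => rw [← orthProj_apply_of_mem h1 (hψa ⟨F.toCLM y, hmF y⟩)]
      rw [inner_apply, star_orthProj h1]
    -- Both sides are now limits of inner products along approximating sequences, which agree term
    -- by term because `|T| |T| = T* T`.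
    rw [e1, e2]
    obtain ⟨z, hz, hz'⟩ := hφ ⟨E.toCLM x, hmE x⟩
    obtain ⟨w, hw, hw'⟩ := hψ ⟨F.toCLM y, hmF y⟩
    have l1 := tendsto_inner (A := A) hz' hw
    have l2 := tendsto_inner (A := A) hz hw'
    simp only [inner_apply_apply_eq hiso] at l2
    exact tendsto_nhds_unique l1 l2
  set U : Adjointable A H := ofFun _ _ hadj
  have hUx : ∀ x, U.toCLM x = φ ⟨E.toCLM x, hmE x⟩ := ofFun_apply _ _ hadj
  have hUsx : ∀ x, (star U).toCLM x = ψ ⟨F.toCLM x, hmF x⟩ := fun x => by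
    refine eq_of_inner_left (A := A) fun w => ?_
    rw [← inner_apply, hUx, hadj]
  have hUU : star U * U = E := by
    refine ext fun x => ?_
    rw [mul_apply, hUsx]
    obtain ⟨z, hz, hz'⟩ := hφ ⟨E.toCLM x, hmE x⟩
    obtain ⟨w, hw, hw'⟩ := hψ ⟨F.toCLM (U.toCLM x), hmF _⟩
    have e : F.toCLM (U.toCLM x) = φ ⟨E.toCLM x, hmE x⟩ := by
      rw [hUx]
      exact orthProj_apply_of_mem h2 (hφT _)
    have hw2 : Filter.Tendsto (fun n => T.toCLM (w n)) Filter.atTop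
        (nhds (φ ⟨E.toCLM x, hmE x⟩)) := by
      rw [← e]
      exact hw
    -- `T z_n` and `T w_n` have the same limit, so `|T| z_n` and `|T| w_n` do too: `E x` and `U* U
    -- x`.
    exact tendsto_nhds_unique hw' (tendsto_of_tendsto hiso.symm hz' hw2 hz)
  refine ⟨h1, U, ?_, ?_, hUU⟩
  · rw [mul_assoc, hUU]
    refine ext fun x => ?_
    rw [mul_apply, hUx, hUx]
    congr 1
    exact Subtype.ext (hEE x)
  · refine ext fun x => ?_
    rw [mul_apply, hUx]
    obtain ⟨z, hz, hz'⟩ := hφ ⟨E.toCLM (a.toCLM x), hmE _⟩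
    have e : E.toCLM (a.toCLM x) = a.toCLM x := by
      refine orthProj_apply_of_mem h1 ?_
      rw [← closure_range_abs]
      exact apply_mem_closure a x
    have hz2 : Filter.Tendsto (fun n => a.toCLM (z n)) Filter.atTop (nhds (a.toCLM x)) := by
      rw [← e]
      exact hz
    -- The sequence `z` is compared with the constant sequence `x`.
    exact (tendsto_nhds_unique hz' (tendsto_of_tendsto hiso
      (tendsto_const_nhds (x := a.toCLM x)) hz2 (tendsto_const_nhds (x := T.toCLM x)))).symm

theorem hasPolarDecomposition_iff {T : Adjointable A H} :
    HasPolarDecomposition T ↔ OrthComplemented A (range (star T)).topologicalClosure ∧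
      OrthComplemented A (range T).topologicalClosure :=
  ⟨fun h => ⟨h.1, h.orthComplemented⟩, fun h => hasPolarDecomposition_of_orthComplemented h.1 h.2⟩

theorem HasPolarDecomposition.star {T : Adjointable A H} (h : HasPolarDecomposition T) :
    HasPolarDecomposition (star T) := by
  rw [hasPolarDecomposition_iff] at h ⊢
  rw [star_star]
  exact h.symm

/-- Complementedness of the range closure passes from `T` to `S T` if `S` has a left inverse on
the range of `T`. -/
theorem OrthComplemented.of_mul_mul_eq {S T L : Adjointable A H} (hL : L * S * T = T)
    (h : OrthComplemented A (range T).topologicalClosure) :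
    OrthComplemented A (range (S * T)).topologicalClosure := by
  set E := orthProj A (range T).topologicalClosure
  have hLE : L * S * E = E := ext fun x =>
    eqOn_closure_range (S := L * S) (T := 1) (X := T) (by rw [hL, one_mul])
      (orthProj_apply_mem h x)
  have hEE : E * E = E := orthProj_mul_self h
  have hET : E * T = T := orthProj_mul_of_range_le h (range T).le_topologicalClosure
  have e1 : S * E * L * (S * E) = S * E := by
    calc S * E * L * (S * E) = S * E * (L * S * E) := by simp only [mul_assoc]
      _ = S * E := by rw [hLE, mul_assoc, hEE]
  -- `S E L` is an idempotent, not necessarily self-adjoint, whose range is the closure of `R(S T)`;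
  -- ranges of idempotents are complemented.
  have hG : IsIdempotentElem (S * E * L) := by
    change S * E * L * (S * E * L) = S * E * L
    rw [← mul_assoc, e1]
  have hGT : S * E * L * (S * T) = S * T := by
    calc S * E * L * (S * T) = S * (E * (L * S * T)) := by simp only [mul_assoc]
      _ = S * T := by rw [hL, hET]
  have hr : (range (S * T)).topologicalClosure = range (S * E * L) := by
    refine le_antisymm (closure_range_le hGT) ?_
    rintro _ ⟨x, rfl⟩
    exact map_mem_closure_range S T (orthProj_apply_mem h (L.toCLM x))
  rw [hr]
  exact orthComplemented_range hG

/-- Since `T* = (S T)* L*`, the adjoints have the same range. On the other side the hypothesis is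
symmetric: `S` is in turn a left inverse of `L` on `R(S T)`. -/
theorem hasPolarDecomposition_mul_iff {S T L : Adjointable A H} (hL : L * S * T = T) :
    HasPolarDecomposition (S * T) ↔ HasPolarDecomposition T := by
  have hr : range (Star.star (S * T)) = range (Star.star T) := by
    refine le_antisymm ?_ ?_
    · rw [star_mul]
      exact range_mul_le _ _
    · nth_rewrite 1 [← hL]
      rw [mul_assoc, star_mul L]
      exact range_mul_le _ _
  rw [hasPolarDecomposition_iff, hasPolarDecomposition_iff, hr]
  refine and_congr_right fun _ => ⟨fun h => ?_, fun h => h.of_mul_mul_eq hL⟩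
  have := h.of_mul_mul_eq (S := L) (L := S) (by rw [mul_assoc, ← mul_assoc L, hL])
  rwa [← mul_assoc, hL] at this

end Polar

/-! ### Algebra of the matched projection -/

section MatchedData

/-- The algebraic relations between an idempotent `Q`, the projection `p` onto its range, the
operator `a = |Q*|`, its Moore-Penrose inverse `c` and `d = (a + 1)⁻¹`. -/
structure MatchedData {R : Type*} [Ring R] [StarRing R] (Q p a c d : R) : Prop where
  idem : Q * Q = Q
  star_p : star p = p
  p_mul_Q : p * Q = Q
  Q_mul_p : Q * p = p
  star_a : star a = a
  a_mul_a : a * a = Q * star Q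
  star_c : star c = c
  star_d : star d = d
  p_mul_a : p * a = a
  a_mul_c : a * c = p
  c_mul_a : c * a = p
  p_mul_c : p * c = c
  d_left : d * (a + 1) = 1
  d_right : (a + 1) * d = 1

namespace MatchedData

variable {R : Type*} [Ring R] [StarRing R] {Q p a c d : R} (D : MatchedData Q p a c d)
include D

theorem Q_mul_a : Q * a = a := by rw [← D.p_mul_a, ← mul_assoc, D.Q_mul_p]

theorem star_mul_p : star Q * p = star Q := by
  simpa [D.star_p] using congrArg star D.p_mul_Q

theorem p_mul_star : p * star Q = p := by
  simpa [D.star_p] using congrArg star D.Q_mul_p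

theorem a_mul_p : a * p = a := by
  simpa [D.star_p, D.star_a] using congrArg star D.p_mul_a

theorem a_mul_star : a * star Q = a := by
  simpa [D.star_a] using congrArg star D.Q_mul_a

theorem p_mul_p : p * p = p := by
  nth_rewrite 2 [← D.Q_mul_p]
  rw [← mul_assoc, D.p_mul_Q, D.Q_mul_p]

theorem comm_d {x : R} (h : x * a = a * x) : x * d = d * x := by
  calc x * d = d * (a + 1) * (x * d) := by rw [D.d_left, one_mul]
    _ = d * (a * x + x) * d := by simp only [mul_assoc, add_mul, mul_add, one_mul]
    _ = d * x * ((a + 1) * d) := by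
      rw [← h]
      simp only [mul_assoc, add_mul, mul_add, one_mul]
    _ = d * x := by rw [D.d_right, mul_one]

theorem a_mul_d : a * d = d * a := D.comm_d rfl

theorem c_mul_d : c * d = d * c := D.comm_d (by rw [D.a_mul_c, D.c_mul_a])

/-- The cross terms are `a Q* = a` and `Q a = a`, while `Q Q* = a²`. -/
theorem row_mul_star : (a + Q) * (a + star Q) = 2 * (a * (a + 1)) := by
  rw [add_mul, mul_add, mul_add, D.a_mul_star, D.Q_mul_a, ← D.a_mul_a, mul_add, mul_one]
  noncomm_ring

theorem c_d_mul : c * d * (a * (a + 1)) = p := by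
  rw [mul_assoc, ← mul_assoc d, ← D.a_mul_d, mul_assoc, D.d_left, mul_one, D.c_mul_a]

/-- The element here is `2 m(Q)`; clearing the factor `1/2` keeps the computations valid in any star
ring. -/
theorem star_twice :
    star ((a + star Q) * c * d * (a + Q)) = (a + star Q) * c * d * (a + Q) := by
  simp only [star_mul, star_add, star_star, D.star_a, D.star_c, D.star_d]
  rw [mul_assoc (a + star Q), D.c_mul_d]
  simp only [mul_assoc]

theorem twice_mul_twice : (a + star Q) * c * d * (a + Q) * ((a + star Q) * c * d * (a + Q)) =
    2 * ((a + star Q) * c * d * (a + Q)) := by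
  calc _ = (a + star Q) * (c * d) * ((a + Q) * (a + star Q)) * ((c * d) * (a + Q)) := by
        simp only [mul_assoc]
    _ = 2 * ((a + star Q) * (c * d * (a * (a + 1))) * ((c * d) * (a + Q))) := by
        rw [D.row_mul_star]
        noncomm_ring
    _ = 2 * ((a + star Q) * (p * c) * (d * (a + Q))) := by
        rw [D.c_d_mul]
        simp only [mul_assoc]
    _ = _ := by
        rw [D.p_mul_c]
        simp only [mul_assoc]

/-- The correction `Q* c Q` to `Q` is self-adjoint, so it cancels when `2m Q - Q` is compared with
its adjoint. -/
theorem twice_mul_Q : (a + star Q) * c * d * (a + Q) * Q = Q + star Q * c * Q := by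
  calc _ = (a + star Q) * c * (d * ((a + 1) * Q)) := by
        simp only [mul_assoc, add_mul, D.idem, one_mul]
    _ = (a + star Q) * c * Q := by rw [← mul_assoc d, D.d_left, one_mul]
    _ = Q + star Q * c * Q := by rw [add_mul, add_mul, D.a_mul_c, D.p_mul_Q]

theorem star_mul_twice :
    star Q * ((a + star Q) * c * d * (a + Q)) = star Q + star Q * c * Q := by
  have h := congrArg star D.twice_mul_Q
  rw [star_mul, D.star_twice] at h
  rw [h]
  simp only [star_add, star_mul, star_star, D.star_c, mul_assoc]

theorem twice_mul_sub : (a + star Q) * c * d * (a + Q) * (1 - Q) = (a + star Q) * d * (p - Q) := by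
  have h : (a + Q) * (1 - Q) = a * (p - Q) := by
    simp only [add_mul, mul_sub, mul_one, D.idem, D.a_mul_p]
    abel
  calc _ = (a + star Q) * (c * d) * ((a + Q) * (1 - Q)) := by simp only [mul_assoc]
    _ = (a + star Q) * d * (c * a * (p - Q)) := by
        rw [h, D.c_mul_d]
        simp only [mul_assoc]
    _ = _ := by rw [D.c_mul_a, mul_sub, D.p_mul_p, D.p_mul_Q]

theorem c_mul_row_mul : c * (a + Q) * ((a + star Q) * d * (p - Q)) = 2 * (p - Q) := by
  have h : p * (p - Q) = p - Q := by rw [mul_sub, D.p_mul_p, D.p_mul_Q]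
  calc _ = c * ((a + Q) * (a + star Q)) * (d * (p - Q)) := by simp only [mul_assoc]
    _ = 2 * (c * a * ((a + 1) * d) * (p - Q)) := by
        rw [D.row_mul_star]
        noncomm_ring
    _ = _ := by rw [D.d_right, mul_one, D.c_mul_a, h]

theorem N_mul_star : (p - Q) * star (p - Q) = (a + 1) * (a - p) := by
  simp only [star_sub, D.star_p, sub_mul, mul_sub, add_mul, one_mul, D.p_mul_p, D.p_mul_star,
    D.Q_mul_p, ← D.a_mul_a, D.a_mul_p]
  abel

theorem sub_star_eq : a - star Q = (1 + d * (p - Q)) * star (p - Q) := by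
  rw [add_mul, one_mul, mul_assoc, D.N_mul_star, ← mul_assoc, D.d_left, one_mul, star_sub,
    D.star_p]
  abel

/-- With `N = p - Q`, the term `d N N* = a - p` is killed by `1 - p`, while `p N* = 0`. -/
theorem one_sub_p_mul : (1 - p) * (1 + d * (p - Q)) * star (p - Q) = star (p - Q) := by
  rw [mul_assoc, ← D.sub_star_eq, star_sub, D.star_p, sub_mul, mul_sub, mul_sub, D.p_mul_a,
    D.p_mul_star, one_mul, one_mul]
  abel

theorem a_mul_star_mul : a * (star Q * c) * (a - Q) = a - Q := by
  rw [← mul_assoc a, D.a_mul_star, D.a_mul_c, mul_sub, D.p_mul_a, D.p_mul_Q]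

theorem star_mul_c_mul_sub : star Q * c * (a - Q) = star Q - star Q * c * Q := by
  rw [mul_sub, mul_assoc, D.c_mul_a, D.star_mul_p]

end MatchedData

end MatchedData

/-! ### The matched pair and its two polar decompositions -/

section Matched

variable {A H : Type*} [NonUnitalCStarAlgebra A] [PartialOrder A] [StarOrderedRing A]
  [NormedAddCommGroup H] [NormedSpace ℂ H] [SMul A H] [CStarModule A H] [CompleteSpace H]

theorem orthProj_range_mul {Q : Adjointable A H} (hQ : IsIdempotentElem Q) :
    orthProj A (range Q) * Q = Q :=
  orthProj_mul_of_range_le (orthComplemented_range hQ) le_rfl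

theorem mul_orthProj_range {Q : Adjointable A H} (hQ : IsIdempotentElem Q) :
    Q * orthProj A (range Q) = orthProj A (range Q) := by
  refine ext fun x => ?_
  obtain ⟨y, hy⟩ := orthProj_apply_mem (orthComplemented_range hQ) x
  rw [mul_apply, ← hy]
  exact congrArg (fun T : Adjointable A H => T.toCLM y) hQ

theorem matchedData {Q : Adjointable A H} (hQ : IsIdempotentElem Q) :
    MatchedData Q (orthProj A (range Q)) (CFC.abs (star Q)) (pinv (CFC.abs (star Q)))
      (Ring.inverse (CFC.abs (star Q) + 1)) := by
  have hc := isMoorePenrose_pinv hQ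
  have hu := isUnit_abs_add_one (star Q)
  have hsa := star_abs (star Q)
  have haa : CFC.abs (star Q) * CFC.abs (star Q) = Q * star Q := by
    rw [CFC.abs_mul_abs, star_star]
  have hp := star_orthProj (orthComplemented_range hQ)
  have hpQ := orthProj_range_mul hQ
  have hQp := mul_orthProj_range hQ
  set p := orthProj A (range Q)
  set a := CFC.abs (star Q)
  set c := pinv a
  have hsc : star c = c := by
    have h := hc.star
    rw [hsa] at h
    exact h.unique hc
  have hac : a * c = c * a := by rw [← hc.star_left, star_mul, hsa, hsc]
  have hpa : p * a = a := by
    -- Since `a² = Q Q*`, the C*-identity turns `(1 - p) Q = 0` into `(1 - p) a = 0`; the same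
    -- device gives `a c Q = Q` below.
    have h0 : (1 - p) * a * star ((1 - p) * a) = 0 := by
      rw [star_mul, hsa, mul_assoc, ← mul_assoc a, haa, ← mul_assoc, ← mul_assoc, sub_mul,
        one_mul, hpQ, sub_self, zero_mul, zero_mul]
    rw [CStarRing.mul_star_self_eq_zero_iff, sub_mul, one_mul, sub_eq_zero] at h0
    exact h0.symm
  have hacQ : a * c * Q = Q := by
    have h0 : (1 - a * c) * Q * star ((1 - a * c) * Q) = 0 := by
      rw [star_mul, mul_assoc, ← mul_assoc Q, ← haa, ← mul_assoc, ← mul_assoc, sub_mul 1,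
        one_mul, hc.mul_mul_self, sub_self, zero_mul, zero_mul]
    rw [CStarRing.mul_star_self_eq_zero_iff, sub_mul, one_mul, sub_eq_zero] at h0
    exact h0.symm
  have hacp : a * c * p = p := by rw [← hQp, ← mul_assoc, hacQ]
  have hpac : a * c = p := by
    have h := congrArg star hacp
    rw [star_mul, hc.star_left, hp, ← mul_assoc, hpa] at h
    exact h
  have hd1 := Ring.inverse_mul_cancel _ hu
  have hd2 := Ring.mul_inverse_cancel _ hu
  refine ⟨hQ, hp, hpQ, hQp, hsa, haa, hsc, ?_, hpa, hpac, hac ▸ hpac, ?_, hd1, hd2⟩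
  · have h := congrArg star hd1
    rw [star_mul, star_add, hsa, star_one] at h
    exact (left_inv_eq_right_inv hd1 h).symm
  · rw [← hpac, hac, hc.mul_mul_inv]

/-- The matched pair of an idempotent is a quasi-projection pair. -/
theorem isQuasiProjectionPair_matchedProj {Q : Adjointable A H} (hQ : IsIdempotentElem Q) :
    IsQuasiProjectionPair (matchedProj Q) Q := by
  have D := matchedData hQ
  have h1 := D.star_twice
  have h2 := D.twice_mul_twice
  have h3 := D.twice_mul_Q
  have h4 := D.star_mul_twice
  have hm : matchedProj Q + matchedProj Q = (CFC.abs (star Q) + star Q) *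
      pinv (CFC.abs (star Q)) * Ring.inverse (CFC.abs (star Q) + 1) *
      (CFC.abs (star Q) + Q) := by
    rw [matchedProj, ← add_smul]
    norm_num
  have hs : star (matchedProj Q) = matchedProj Q := by
    rw [matchedProj, star_smul, h1]
    norm_num
  have hi : matchedProj Q * matchedProj Q = matchedProj Q := by
    rw [matchedProj, smul_mul_smul_comm, h2, two_mul, ← two_smul ℂ, smul_smul]
    norm_num
  rw [← hm] at h3 h4
  set m := matchedProj Q
  -- This says `(2m - 1) Q = Q* (2m - 1)`. As `2m - 1` acts as `1` on the range of `m` and as `-1`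
  -- on that of `1 - m`, compressing by `m` and `1 - m` yields the three identities with their
  -- signs.
  have key : m * Q + m * Q - Q = star Q * m + star Q * m - star Q := by
    rw [← add_mul, ← mul_add, h3, h4]
    abel
  have hi' : m * (1 - m) = 0 := by rw [mul_sub, mul_one, hi, sub_self]
  have hi'' : (1 - m) * m = 0 := by rw [sub_mul, one_mul, hi, sub_self]
  refine ⟨⟨hi, hs⟩, hQ, ?_, ?_, ?_⟩
  · have e1 : m * (m * Q + m * Q - Q) * m = m * Q * m := by
      calc _ = m * m * Q * m + m * m * Q * m - m * Q * m := by noncomm_ring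
        _ = _ := by rw [hi, add_sub_cancel_right]
    have e2 : m * (star Q * m + star Q * m - star Q) * m = m * star Q * m := by
      calc _ = m * star Q * (m * m) + m * star Q * (m * m) - m * star Q * m := by noncomm_ring
        _ = _ := by rw [hi, add_sub_cancel_right]
    rw [← e1, ← e2, key]
  · have e1 : m * (m * Q + m * Q - Q) * (1 - m) = m * Q * (1 - m) := by
      calc _ = m * m * Q * (1 - m) + m * m * Q * (1 - m) - m * Q * (1 - m) := by noncomm_ring
        _ = _ := by rw [hi, add_sub_cancel_right]
    have e2 : m * (star Q * m + star Q * m - star Q) * (1 - m) = -(m * star Q * (1 - m)) := by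
      calc _ = 2 * (m * star Q * (m * (1 - m))) - m * star Q * (1 - m) := by noncomm_ring
        _ = _ := by rw [hi', mul_zero, mul_zero, zero_sub]
    rw [← e1, key, e2, neg_neg]
  · have e1 : (1 - m) * (m * Q + m * Q - Q) * (1 - m) = -((1 - m) * Q * (1 - m)) := by
      calc _ = 2 * ((1 - m) * m * Q * (1 - m)) - (1 - m) * Q * (1 - m) := by noncomm_ring
        _ = _ := by rw [hi'', zero_mul, zero_mul, mul_zero, zero_sub]
    have e2 : (1 - m) * (star Q * m + star Q * m - star Q) * (1 - m) =
        -((1 - m) * star Q * (1 - m)) := by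
      calc _ = 2 * ((1 - m) * star Q * (m * (1 - m))) - (1 - m) * star Q * (1 - m) := by
            noncomm_ring
        _ = _ := by rw [hi', mul_zero, mul_zero, zero_sub]
    rw [← neg_inj, ← e1, ← e2, key]

theorem hasPolarDecomposition_matchedProj_mul_iff {Q : Adjointable A H}
    (hQ : IsIdempotentElem Q) :
    HasPolarDecomposition (matchedProj Q * (1 - Q)) ↔
      HasPolarDecomposition (orthProj A (range Q) - Q) := by
  have D := matchedData hQ
  have e : matchedProj Q * (1 - Q) = (1 / 2 : ℂ) • ((CFC.abs (star Q) + star Q) *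
      Ring.inverse (CFC.abs (star Q) + 1)) * (orthProj A (range Q) - Q) := by
    rw [matchedProj, smul_mul_assoc, smul_mul_assoc, D.twice_mul_sub]
  rw [e]
  refine hasPolarDecomposition_mul_iff
    (L := pinv (CFC.abs (star Q)) * (CFC.abs (star Q) + Q)) ?_
  rw [mul_smul_comm, smul_mul_assoc, mul_assoc _ _ (orthProj A (range Q) - Q), D.c_mul_row_mul,
    two_mul, ← two_smul ℂ, smul_smul]
  norm_num

theorem hasPolarDecomposition_one_sub_matchedProj_mul {Q : Adjointable A H}
    (hQ : IsIdempotentElem Q) (h : HasPolarDecomposition (orthProj A (range Q) - Q)) :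
    HasPolarDecomposition ((1 - matchedProj Q) * Q) := by
  have D := matchedData hQ
  have h1 : HasPolarDecomposition (CFC.abs (star Q) - star Q) := by
    rw [D.sub_star_eq]
    exact (hasPolarDecomposition_mul_iff D.one_sub_p_mul).mpr h.star
  have h2 : HasPolarDecomposition (CFC.abs (star Q) - Q) := by
    have := h1.star
    rwa [star_sub, star_star, D.star_a] at this
  -- The adjoint is used because it has `Q* c` as a left factor, which `2a` undoes after the scalar
  -- `1/2`.
  have e : star ((1 - matchedProj Q) * Q) =
      (1 / 2 : ℂ) • (star Q * pinv (CFC.abs (star Q))) * (CFC.abs (star Q) - Q) := by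
    have hs := (isQuasiProjectionPair_matchedProj hQ).isStarProjection.isSelfAdjoint.star_eq
    rw [smul_mul_assoc, D.star_mul_c_mul_sub, star_mul, star_sub, star_one, hs, mul_sub, mul_one,
      matchedProj, mul_smul_comm, D.star_mul_twice]
    module
  have h3 : HasPolarDecomposition (star ((1 - matchedProj Q) * Q)) := by
    rw [e]
    refine (hasPolarDecomposition_mul_iff (L := (2 : ℂ) • CFC.abs (star Q)) ?_).mpr h2
    rw [smul_mul_smul_comm, smul_mul_assoc, D.a_mul_star_mul]
    norm_num
  have := h3.star
  rwa [star_star] at this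

end Matched

end Adjointable

theorem mainTheorem6 {A H : Type*} [NonUnitalCStarAlgebra A] [PartialOrder A] [StarOrderedRing A]
    [NormedAddCommGroup H] [NormedSpace ℂ H] [SMul A H] [CStarModule A H] [CompleteSpace H]
    (Q : Adjointable A H) (hQ : IsIdempotentElem Q) :
    Adjointable.IsSemiHarmonious (Adjointable.matchedProj Q) Q ↔
      Adjointable.HasPolarDecomposition (Adjointable.orthProj A (Adjointable.range Q) - Q) :=
  ⟨fun h => (Adjointable.hasPolarDecomposition_matchedProj_mul_iff hQ).mp h.polar_left, fun h =>
    ⟨Adjointable.isQuasiProjectionPair_matchedProj hQ,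
      (Adjointable.hasPolarDecomposition_matchedProj_mul_iff hQ).mpr h,
      Adjointable.hasPolarDecomposition_one_sub_matchedProj_mul hQ h⟩⟩
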